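/- Let $\psi$ be a matrix product state (MPS) with open boundary conditions on $N$ sites, with local dimension $d$ and bond dimension $\chi$, i.e. a family of complex $\chi\times\chi$ matrices $A^{(i)}_k$ ($1\le i\le N$, $1\le k\le d$) and vectors $l,r\in\mathbb C^\chi$, with amplitudes $\Psi(s)=l^{T}A^{(1)}_{s_1}\cdots A^{(N)}_{s_N}r$ for $s\in\{1,\dots,d\}^N$. We say that $\psi$ has $b$ bits of precision if all entries of the matrices and of $l,r$ have modulus at most $2^b$, and for every $s$ each of $\operatorname{Re}\Psi(s)$, $\operatorname{Im}\Psi(s)$ is either $0$ or at least $2^{-b}$ in absolute value. A neural network is a finite directed acyclic graph with real weights on its edges, whose inputs are the indicators $\mathbf 1[s_i=k]$ and whose other nodes $v$ (with real biases $b_v$) take the value $\sigma\bigl(b_v+\sum_{(u,v)\in E}W_{u,v}\,u(s)\bigr)$, where $\sigma(t)=\ln(1+e^t)$ is the softplus function; its two outputs $g_1,g_2$ are two distinct nodes without outgoing edges (roots), which may use the identity in place of $\sigma$. Its depth is the length of a longest directed path from an input to one of these two roots. It $\varepsilon$-approximates $\log\Psi$ if $|g_1(s)+i\,g_2(s)-\log\Psi(s)|<\varepsilon$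 for every $s$, with the principal branch of the logarithm. Let $0<\varepsilon\le 1$, and let $\psi$ be any MPS with $b$ bits of precision such that $\Psi(s)\ne0$ for all $s$. 1. (Sequential contraction.) The function $\Psi$, evaluated by contracting the boundary vector successively with one site matrix after the other, is $\varepsilon$-approximated in this sense by a neural network of depth $\tilde O\bigl(N+\sqrt{1/\varepsilon}\bigr)$ with $\tilde O\bigl(Nd\chi^2+\sqrt{1/\varepsilon}\bigr)$ edges. 2. (Parallel contraction.) The function $\Psi$, evaluated by multiplying neighbouring matrices in disjoint pairs in $\lceil\log_2N\rceil$ parallel steps, is $\varepsilon$-approximated in this sense by a neural network of depth $\tilde O\bigl(\ln N+\sqrt{1/\varepsilon}\bigr)$ with $\tilde O\bigl(N(d+\chi)\chi^2+\sqrt{1/\varepsilon}\bigr)$ edges. Here $X=\tilde O(Y)$ means $X\le C\,Y\,\ln^p\bigl(2+N+d+\chi+b+1/\varepsilon\bigr)$, where $C>0$ and $p\in\mathbb N$ are absolute constants (independent of $N,d,\chi,b,\varepsilon$ and $\psi$). -/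

import Mathlib

open scoped Matrix

/-! ### Matrix product states -/

/-- A matrix product state (open boundary conditions) on `N` sites with local dimension `d` and bond
dimension `χ`: one `χ × χ` complex matrix for each site and each local value, and two boundary
vectors. -/
structure MPS (N d χ : ℕ) where
  /-- the matrices `A⁽ⁱ⁾_k` -/
  site : Fin N → Fin d → Matrix (Fin χ) (Fin χ) ℂ
  /-- the left boundary vector -/
  left : Fin χ → ℂ
  /-- the right boundary vector -/
  right : Fin χ → ℂ

namespace MPS

variable {N d χ : ℕ}

/-- The matrices selected by a configuration `s`, from the first site to the last. -/
def matrices (A : MPS N d χ) (s : Fin N → Fin d) : List (Matrix (Fin χ) (Fin χ) ℂ) :=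
  List.ofFn fun i => A.site i (s i)

/-- The amplitude `Ψ(s) = ⟨left| A⁽¹⁾_{s₁} ⋯ A⁽ᴺ⁾_{s_N} |right⟩` (no complex conjugation). -/
def amplitude (A : MPS N d χ) (s : Fin N → Fin d) : ℂ :=
  A.left ⬝ᵥ ((A.matrices s).prod *ᵥ A.right)

/-- Sequential contraction: the boundary vector is contracted with one matrix after the other. -/
def sequentialContraction (A : MPS N d χ) (s : Fin N → Fin d) : ℂ :=
  (A.matrices s).foldl (fun v M => v ᵥ* M) A.left ⬝ᵥ A.right

/-- One parallel step: neighbouring matrices are multiplied in disjoint pairs; a last matrix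
without a partner is kept. -/
def pairStep {M : Type} [Mul M] : List M → List M
  | a :: b :: l => (a * b) :: pairStep l
  | [a] => [a]
  | [] => []

/-- Parallel contraction: `⌈log₂ N⌉` parallel steps leave a single matrix (none if `N = 0`), which
is contracted with the boundary vectors. -/
def parallelContraction (A : MPS N d χ) (s : Fin N → Fin d) : ℂ :=
  A.left ⬝ᵥ (((pairStep^[Nat.clog 2 N]) (A.matrices s)).headD 1 *ᵥ A.right)

theorem sequentialContraction_eq (A : MPS N d χ) (s : Fin N → Fin d) :
    A.sequentialContraction s = A.amplitude s := by
  have key : ∀ (l : List (Matrix (Fin χ) (Fin χ) ℂ)) (v : Fin χ → ℂ),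
      l.foldl (fun v M => v ᵥ* M) v = v ᵥ* l.prod := by
    intro l
    induction l with
    | nil => intro v; simp
    | cons M l ih => intro v; simp [ih, Matrix.vecMul_vecMul]
  rw [sequentialContraction, amplitude, key, Matrix.dotProduct_mulVec]

theorem pairStep_prod {M : Type} [Monoid M] (l : List M) : (pairStep l).prod = l.prod := by
  induction l using pairStep.induct with
  | case1 a b l ih => simp [pairStep, ih, mul_assoc]
  | case2 a => simp [pairStep]
  | case3 => simp [pairStep]

theorem pairStep_length {M : Type} [Mul M] (l : List M) :
    (pairStep l).length = (l.length + 1) / 2 := by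
  induction l using pairStep.induct with
  | case1 a b l ih => simp only [pairStep, List.length_cons, ih]; omega
  | case2 a => simp [pairStep]
  | case3 => simp [pairStep]

theorem pairStep_iterate {M : Type} [Monoid M] (k : ℕ) (l : List M) (h : l.length ≤ 2 ^ k) :
    ((pairStep^[k]) l).headD 1 = l.prod := by
  induction k generalizing l with
  | zero =>
    match l, h with
    | [], _ => simp
    | [a], _ => simp
    | a :: b :: l, h => simp at h
  | succ k ih =>
    rw [Function.iterate_succ_apply, ih _ (by rw [pairStep_length]; rw [pow_succ] at h; omega),
      pairStep_prod]

theorem parallelContraction_eq (A : MPS N d χ) (s : Fin N → Fin d) :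
    A.parallelContraction s = A.amplitude s := by
  rw [parallelContraction, amplitude, pairStep_iterate]
  simpa [matrices] using Nat.le_pow_clog one_lt_two N

/-- `b` bits of precision: no parameter exceeds `2 ^ b` in modulus, and the real and the imaginary
part of an amplitude are zero or at least `2⁻ᵇ` in absolute value. -/
structure HasPrecision (A : MPS N d χ) (b : ℕ) : Prop where
  site_le : ∀ i k α β, ‖A.site i k α β‖ ≤ 2 ^ b
  left_le : ∀ α, ‖A.left α‖ ≤ 2 ^ b
  right_le : ∀ α, ‖A.right α‖ ≤ 2 ^ b
  re_ge : ∀ s, (A.amplitude s).re = 0 ∨ ((2 : ℝ) ^ b)⁻¹ ≤ |(A.amplitude s).re|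
  im_ge : ∀ s, (A.amplitude s).im = 0 ∨ ((2 : ℝ) ^ b)⁻¹ ≤ |(A.amplitude s).im|

end MPS

/-! ### Feed-forward neural networks -/

/-- The activation function. -/
noncomputable def softplus (t : ℝ) : ℝ := Real.log (Real.exp t + 1)

/-- A feed-forward neural network with two real outputs: a finite directed acyclic graph whose nodes
are the inputs `ι` (without incoming edges) and the neurons `V`. There is an edge from `u` to `v`
exactly if `u ∈ parents v`. The outputs are two distinct neurons without outgoing edges (roots). -/
structure NeuralNet (ι : Type) where
  /-- the neurons -/
  V : Type
  [fintypeV : Fintype V]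
  /-- the sources of the edges into a neuron -/
  parents : V → Finset (ι ⊕ V)
  /-- there is no directed cycle -/
  acyclic : WellFounded fun u v : V => Sum.inr u ∈ parents v
  /-- the weight of the edge `(u, v)`, of no effect where there is no edge -/
  weight : ι ⊕ V → V → ℝ
  /-- the biases -/
  bias : V → ℝ
  /-- the two roots -/
  root : Fin 2 → V
  root_injective : Function.Injective root
  root_sink : ∀ j v, Sum.inr (root j) ∉ parents v
  /-- the roots that use the identity in place of the activation function -/
  linearRoots : Set (Fin 2)

namespace NeuralNet

variable {ι : Type}

attribute [instance] NeuralNet.fintypeV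

open Classical in
/-- The function applied at a neuron: softplus, or the identity at a linear root. -/
noncomputable def activation (net : NeuralNet ι) (v : net.V) (t : ℝ) : ℝ :=
  if ∃ j ∈ net.linearRoots, net.root j = v then t else softplus t

/-- The value of a neuron on the input `x`, by recursion along the graph. -/
noncomputable def value (net : NeuralNet ι) (x : ι → ℝ) : net.V → ℝ :=
  net.acyclic.fix fun v rec =>
    net.activation v (net.bias v + ∑ u : {u // u ∈ net.parents v},
      net.weight u.1 v * (match u with
        | ⟨Sum.inl i, _⟩ => x i
        | ⟨Sum.inr w, h⟩ => rec w h))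

theorem value_eq (net : NeuralNet ι) (x : ι → ℝ) (v : net.V) :
    net.value x v = net.activation v
      (net.bias v + ∑ u ∈ net.parents v, net.weight u v * Sum.elim x (net.value x) u) := by
  rw [← Finset.sum_coe_sort (net.parents v)
    fun u => net.weight u v * Sum.elim x (net.value x) u]
  conv_lhs => rw [value, WellFounded.fix_eq]
  congr 2
  refine Finset.sum_congr rfl fun u _ => ?_
  obtain ⟨u | u, hu⟩ := u <;> rfl

/-- The two outputs of the network. -/
noncomputable def output (net : NeuralNet ι) (x : ι → ℝ) (j : Fin 2) : ℝ :=
  net.value x (net.root j)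

/-- The number of edges. -/
def numEdges (net : NeuralNet ι) : ℕ := ∑ v, (net.parents v).card

/-- `net.HasPath i v n`: there is a directed path with `n` edges from the input `i` to the
neuron `v`. -/
inductive HasPath (net : NeuralNet ι) (i : ι) : net.V → ℕ → Prop
  | first {v : net.V} (h : Sum.inl i ∈ net.parents v) : HasPath net i v 1
  | step {u v : net.V} {n : ℕ} (p : HasPath net i u n) (h : Sum.inr u ∈ net.parents v) :
      HasPath net i v (n + 1)

/-- The depth: the length of a longest directed path from an input to a root
(`0` if there is none). -/
noncomputable def depth (net : NeuralNet ι) : ℕ :=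
  sSup {n | ∃ i j, net.HasPath i (net.root j) n}

/-- The supremum that defines the depth is that of a bounded set. -/
theorem bddAbove_depth (net : NeuralNet ι) :
    BddAbove {n | ∃ i j, net.HasPath i (net.root j) n} := by
  have key : ∀ v, ∃ B, ∀ i n, net.HasPath i v n → n ≤ B := by
    intro v
    induction v using net.acyclic.induction with
    | _ v ih =>
      have ih' : ∀ u, ∃ B, Sum.inr u ∈ net.parents v → ∀ i n, net.HasPath i u n → n ≤ B := by
        intro u
        by_cases h : Sum.inr u ∈ net.parents v
        · obtain ⟨B, hB⟩ := ih u h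
          exact ⟨B, fun _ => hB⟩
        · exact ⟨0, fun h' => absurd h' h⟩
      choose B hB using ih'
      refine ⟨Finset.univ.sup B + 1, fun i n hp => ?_⟩
      cases hp with
      | first h => omega
      | step p h =>
        have h1 := hB _ h i _ p
        have h2 := Finset.le_sup (f := B) (Finset.mem_univ _) |> h1.trans
        omega
  choose B hB using key
  refine ⟨max (B (net.root 0)) (B (net.root 1)), ?_⟩
  rintro n ⟨i, j, hp⟩
  have h := hB _ i n hp
  fin_cases j
  · exact h.trans (le_max_left _ _)
  · exact h.trans (le_max_right _ _)

/-- On every configuration `s`, fed in through the indicators of `sᵢ = k`, the outputs `g₁`, `g₂` of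
the network satisfy `|g₁ + i g₂ - log f(s)| < ε`, with the principal branch of the logarithm. -/
def ApproximatesLog {N d : ℕ} (net : NeuralNet (Fin N × Fin d)) (f : (Fin N → Fin d) → ℂ)
    (ε : ℝ) : Prop :=
  ∀ s : Fin N → Fin d,
    let x : Fin N × Fin d → ℝ := fun p => if s p.1 = p.2 then 1 else 0
    ‖((net.output x 0 : ℂ) + Complex.I * (net.output x 1 : ℂ)) - Complex.log (f s)‖ < ε

end NeuralNet

/-- The logarithm of all the parameters jointly; the logarithmic factors that a bound in
`Õ`-notation leaves out are a fixed power of it. -/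
noncomputable def logFactor (N d χ b : ℕ) (ε : ℝ) : ℝ :=
  Real.log (2 + N + d + χ + b + 1 / ε)

/-! The weights may be arbitrary reals and there are only finitely many configurations, so a bounded
number of softplus neurons imitates any arithmetic gate to any accuracy: a shifted softplus tends to
the identity, a rescaled second-order expansion at the origin to a product, a steep difference to
the step function. `Computes` records that circuits of bounded rank and size reach every accuracy.
It is stable under neuron layers, because softplus is 1-Lipschitz, and under pointwise limits,
because the domain is finite (`softplus_layer`, `of_tendsto`). Hence the arithmetic circuits of both
contractions carry over with constant overhead (`computes_sequential`, `computes_parallel`).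

The logarithm is found by binary search (`exists_log_approx`). A splitting `log Ψ = ℓ + acc` is
maintained in which only `exp ℓ` and `acc` are available. The sign of `Re ℓ` is that of `|exp ℓ|² -
1`, the sign of `Im ℓ` that of `Im (exp ℓ)`; moving a constant from `ℓ` to `acc` multiplies `exp ℓ`
by a constant. Each bit costs boundedly many neurons. Precision gives `|log |Ψ|| ≤ (N + 2) (b + χ)`,
so `O(logFactor)` bits suffice, and `√(1 / ε)` serves only as a quantity that is at least `1`. -/

open Filter Topology

/-! ### Softplus and its limiting gates -/

theorem softplus_mono : Monotone softplus := fun s t h =>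
  Real.log_le_log (by positivity) (by gcongr)

theorem softplus_le_add {s t : ℝ} (h : s ≤ t) : softplus t ≤ softplus s + (t - s) := by
  have h1 : Real.exp t + 1 ≤ (Real.exp s + 1) * Real.exp (t - s) := by
    have h2 : Real.exp t = Real.exp s * Real.exp (t - s) := by rw [← Real.exp_add]; ring_nf
    have h3 : 1 ≤ Real.exp (t - s) := Real.one_le_exp (by linarith)
    nlinarith
  calc softplus t ≤ Real.log ((Real.exp s + 1) * Real.exp (t - s)) :=
        Real.log_le_log (by positivity) h1
    _ = _ := by rw [Real.log_mul (by positivity) (by positivity), Real.log_exp]; rfl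

/-- This Lipschitz bound controls how errors pass through a neuron. -/
theorem abs_softplus_sub_le (s t : ℝ) : |softplus s - softplus t| ≤ |s - t| := by
  rcases le_total s t with h | h
  · have h1 := softplus_le_add h
    have h2 := softplus_mono h
    rw [abs_of_nonpos (by linarith), abs_of_nonpos (by linarith)]; linarith
  · have h1 := softplus_le_add h
    have h2 := softplus_mono h
    rw [abs_of_nonneg (by linarith), abs_of_nonneg (by linarith)]; linarith

theorem softplus_sub_self (t : ℝ) : softplus t - t = Real.log (1 + Real.exp (-t)) := by
  have : Real.exp t + 1 = Real.exp t * (1 + Real.exp (-t)) := by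
    rw [mul_add, ← Real.exp_add]; simp
  rw [softplus, this, Real.log_mul (by positivity) (by positivity), Real.log_exp]; ring

theorem tendsto_softplus_sub_self : Tendsto (fun t => softplus t - t) atTop (𝓝 0) := by
  simp_rw [softplus_sub_self]
  have h1 : Tendsto (fun t : ℝ => 1 + Real.exp (-t)) atTop (𝓝 (1 + 0)) :=
    tendsto_const_nhds.add Real.tendsto_exp_neg_atTop_nhds_zero
  have h2 := (Real.continuousAt_log (x := 1 + 0) (by norm_num)).tendsto.comp h1
  simpa [Function.comp_def] using h2

theorem tendsto_softplus_atBot : Tendsto softplus atBot (𝓝 0) := by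
  have h1 : Tendsto (fun t : ℝ => Real.exp t + 1) atBot (𝓝 (0 + 1)) :=
    Real.tendsto_exp_atBot.add tendsto_const_nhds
  have h2 := (Real.continuousAt_log (x := 0 + 1) (by norm_num)).tendsto.comp h1
  rw [zero_add, Real.log_one] at h2
  exact h2

theorem hasDerivAt_softplus (t : ℝ) :
    HasDerivAt softplus (Real.exp t / (Real.exp t + 1)) t :=
  ((Real.hasDerivAt_exp t).add_const 1).log (by positivity)

/-- A shifted softplus approximates the identity. -/
theorem tendsto_softplus_shift (t : ℝ) :
    Tendsto (fun B => -B + 1 * softplus (B + t)) atTop (𝓝 t) := by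
  have h1 : Tendsto (fun B : ℝ => B + t) atTop atTop := tendsto_atTop_add_const_right _ _ tendsto_id
  have h2 := (tendsto_softplus_sub_self.comp h1).add_const t
  simp only [zero_add] at h2
  refine h2.congr fun B => ?_
  simp only [Function.comp]; ring

/-- The second-order behaviour of softplus at the origin. -/
theorem tendsto_softplus_div_sq :
    Tendsto (fun t => (2 * softplus t - t - 2 * Real.log 2) / t ^ 2) (𝓝[≠] 0) (𝓝 (1 / 4)) := by
  -- `2 * softplus t - t` equals `2 log (2 cosh (t / 2))`, which is even. So there is no linear
  -- term, and the limit is half the second derivative `1 / 2`.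
  have hd : ∀ t : ℝ, HasDerivAt (fun t => 2 * softplus t - t - 2 * Real.log 2)
      (2 * (Real.exp t / (Real.exp t + 1)) - 1) t := fun t =>
    (((hasDerivAt_softplus t).const_mul 2).sub (hasDerivAt_id t)).sub_const _
  have hd2 : HasDerivAt (fun t : ℝ => 2 * (Real.exp t / (Real.exp t + 1)) - 1) (1 / 2) 0 := by
    have := (((Real.hasDerivAt_exp 0).div ((Real.hasDerivAt_exp 0).add_const 1)
      (by positivity)).const_mul 2).sub_const 1
    have hv : (1 : ℝ) / 2 = 2 * ((Real.exp 0 * (Real.exp 0 + 1) - Real.exp 0 * Real.exp 0)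
        / (Real.exp 0 + 1) ^ 2) := by rw [Real.exp_zero]; norm_num
    rw [hv]; exact this
  refine HasDerivAt.lhopital_zero_nhdsNE (f' := fun t => 2 * (Real.exp t / (Real.exp t + 1)) - 1)
    (g' := fun t => 2 * t) (Eventually.of_forall hd)
    (Eventually.of_forall fun t => by simpa using hasDerivAt_pow 2 t) ?_ ?_ ?_ ?_
  · filter_upwards [self_mem_nhdsWithin] with t ht
    simpa using ht
  · have := ((hd 0).continuousAt.tendsto).mono_left (nhdsWithin_le_nhds (s := {0}ᶜ))
    convert this using 2
    simp [softplus]; norm_num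
  · have : Tendsto (fun t : ℝ => t ^ 2) (𝓝 0) (𝓝 (0 ^ 2)) := (continuous_pow 2).tendsto 0
    simpa using this.mono_left (nhdsWithin_le_nhds (s := {0}ᶜ))
  · have h := (hasDerivAt_iff_tendsto_slope.1 hd2).const_mul (1 / 2)
    norm_num at h ⊢
    refine h.congr' ?_
    filter_upwards [self_mem_nhdsWithin] with t ht
    have ht : t ≠ 0 := by simpa using ht
    simp [slope_def_field]
    field_simp
    ring

theorem tendsto_square_gate (t : ℝ) :
    Tendsto (fun δ => (2 * softplus (δ * t) - δ * t - 2 * Real.log 2) / δ ^ 2) (𝓝[≠] 0)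
      (𝓝 (t ^ 2 / 4)) := by
  by_cases ht : t = 0
  · subst ht
    have : (fun δ : ℝ => (2 * softplus (δ * 0) - δ * 0 - 2 * Real.log 2) / δ ^ 2) = fun _ => 0 := by
      funext δ; simp [softplus]; left; norm_num
    rw [this]; simp
  · have h1 : Tendsto (fun δ : ℝ => δ * t) (𝓝[≠] 0) (𝓝[≠] 0) := by
      refine tendsto_nhdsWithin_iff.2 ⟨?_, ?_⟩
      · have : Tendsto (fun δ : ℝ => δ * t) (𝓝 0) (𝓝 (0 * t)) :=
          (continuous_id.mul continuous_const).tendsto 0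
        simpa using this.mono_left (nhdsWithin_le_nhds (s := {0}ᶜ))
      · filter_upwards [self_mem_nhdsWithin] with δ hδ
        exact mul_ne_zero hδ ht
    have h2 := (tendsto_softplus_div_sq.comp h1).mul_const (t ^ 2)
    rw [show t ^ 2 / 4 = 1 / 4 * t ^ 2 by ring]
    refine h2.congr' ?_
    filter_upwards [self_mem_nhdsWithin] with δ hδ
    have hδ : δ ≠ 0 := hδ
    simp only [Function.comp]
    field_simp

/-- Two softplus neurons and a linear term approximate a product. -/
theorem tendsto_product_gate (s t : ℝ) :
    Tendsto (fun δ => 2 / δ ^ 2 * softplus (δ * s + δ * t)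
      + -2 / δ ^ 2 * softplus (δ * s + -δ * t) + -2 / δ * t) (𝓝[≠] 0) (𝓝 (s * t)) := by
  -- Polarization: the constants `2 log 2` cancel, and the linear parts leave only a multiple of
  -- `t`.
  have h := (tendsto_square_gate (s + t)).sub (tendsto_square_gate (s - t))
  rw [show (s + t) ^ 2 / 4 - (s - t) ^ 2 / 4 = s * t by ring] at h
  refine h.congr' ?_
  filter_upwards [self_mem_nhdsWithin] with δ hδ
  have hδ : δ ≠ 0 := hδ
  rw [show δ * s + δ * t = δ * (s + t) by ring, show δ * s + -δ * t = δ * (s - t) by ring]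
  field_simp
  ring

/-- A steep difference of two softplus neurons approximates the step function. -/
theorem tendsto_step_gate (t : ℝ) :
    Tendsto (fun B => 1 * softplus (B + 1 + B ^ 2 * t) + -1 * softplus (B + B ^ 2 * t)) atTop
      (𝓝 (if 0 ≤ t then 1 else 0)) := by
  split_ifs with ht
  -- The shift `B` makes the limit `1` also at `t = 0`; for `t < 0` it is dominated by `B ^ 2 * t`.
  · have h1 : Tendsto (fun B : ℝ => B + B ^ 2 * t) atTop atTop :=
      tendsto_atTop_mono (fun B => by simpa using mul_nonneg (sq_nonneg B) ht) tendsto_id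
    have h2 : Tendsto (fun B : ℝ => B + 1 + B ^ 2 * t) atTop atTop :=
      tendsto_atTop_mono (fun B => by linarith) h1
    have h3 := ((tendsto_softplus_sub_self.comp h2).sub
      (tendsto_softplus_sub_self.comp h1)).add_const 1
    simp only [sub_zero, zero_add] at h3
    refine h3.congr fun B => ?_
    simp only [Function.comp]; ring
  · have ht : t < 0 := not_le.1 ht
    have key : ∀ a : ℝ, Tendsto (fun B : ℝ => B + a + B ^ 2 * t) atTop atBot := by
      intro a
      have h0 : Tendsto (fun B : ℝ => 1 + B * t) atTop atBot :=
        tendsto_atBot_add_const_left _ _ (tendsto_id.atTop_mul_const_of_neg ht)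
      have h1 := tendsto_atBot_add_const_right atTop a (tendsto_id.atTop_mul_atBot₀ h0)
      refine h1.congr fun B => ?_
      simp only [id]; ring
    have h1 := tendsto_softplus_atBot.comp (key 1)
    have h2 := tendsto_softplus_atBot.comp (key 0)
    have h3 := h1.sub h2
    simp only [sub_zero] at h3
    refine h3.congr fun B => ?_
    simp only [Function.comp, add_zero]; ring

/-! ### Softplus circuits -/

/-- A directed acyclic graph of softplus neurons on the inputs `ι`, together with its values on the
inputs `input · x` for `x : X`, and a rank that bounds the length of the paths from the inputs. -/
structure SoftplusCircuit {ι X : Type} (input : ι → X → ℝ) where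
  V : Type
  [fintypeV : Fintype V]
  parents : V → Finset (ι ⊕ V)
  rank : V → ℕ
  rank_lt : ∀ v, ∀ u ∈ parents v, Sum.elim (fun _ => 0) rank u < rank v
  weight : ι ⊕ V → V → ℝ
  bias : V → ℝ
  -- Values are data determined by `value_eq`, so that a new layer can supply its values without
  -- recursion.
  value : V → X → ℝ
  value_eq : ∀ v x, value v x =
    softplus (bias v + ∑ u ∈ parents v, weight u v * Sum.elim input value u x)

namespace SoftplusCircuit

attribute [instance] SoftplusCircuit.fintypeV

variable {ι X : Type} {input : ι → X → ℝ}

/-- The function of `x` available at an input or a neuron. -/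
def signal (c : SoftplusCircuit input) : ι ⊕ c.V → X → ℝ := Sum.elim input c.value

/-- The rank, extended by zero to the inputs. -/
def level (c : SoftplusCircuit input) : ι ⊕ c.V → ℕ := Sum.elim (fun _ => 0) c.rank

/-- The number of edges. -/
def numEdges (c : SoftplusCircuit input) : ℕ := ∑ v, (c.parents v).card

open Classical in
/-- The circuit with one more layer of neurons, each of them reading the nodes `src m k`. -/
noncomputable def extend (c : SoftplusCircuit input) {μ κ : Type} [Fintype μ] [Fintype κ] (D : ℕ)
    (src : μ → κ → ι ⊕ c.V) (hsrc : ∀ m k, c.level (src m k) ≤ D) (W : μ → κ → ℝ) (b : μ → ℝ) :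
    SoftplusCircuit input where
  V := c.V ⊕ μ
  parents := Sum.elim
    (fun v => (c.parents v).map ((Function.Embedding.refl ι).sumMap Function.Embedding.inl))
    (fun m => Finset.univ.image fun k => Sum.map id Sum.inl (src m k))
  rank := Sum.elim c.rank fun _ => D + 1
  rank_lt := by
    rintro (v | m) u hu
    · obtain ⟨w, hw, rfl⟩ := Finset.mem_map.1 hu
      have := c.rank_lt v w hw
      cases w <;> simpa using this
    · obtain ⟨k, -, rfl⟩ := Finset.mem_image.1 hu
      have := hsrc m k
      rw [level] at this
      generalize src m k = w at this
      cases w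
      · simp
      · simpa [Nat.lt_succ_iff] using this
  weight u v := Sum.elim
    (fun v => Sum.elim (fun i => c.weight (Sum.inl i) v)
      (Sum.elim (fun w => c.weight (Sum.inr w) v) fun _ => 0) u)
    -- Sources may coincide for different `k`; the merged edge carries the sum of their weights.
    (fun m => ∑ k with Sum.map id Sum.inl (src m k) = u, W m k) v
  bias := Sum.elim c.bias b
  value := Sum.elim c.value fun m x => softplus (b m + ∑ k, W m k * c.signal (src m k) x)
  value_eq := by
    have key : ∀ (g : μ → X → ℝ) (w : ι ⊕ c.V) (x : X),
        Sum.elim input (Sum.elim c.value g) (Sum.map id Sum.inl w) x = c.signal w x := by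
      rintro g (i | w) x <;> rfl
    rintro (v | m) x
    · simp only [Sum.elim_inl, Finset.sum_map]
      rw [c.value_eq]
      congr 2
      refine Finset.sum_congr rfl fun u _ => ?_
      cases u <;> rfl
    · simp only [Sum.elim_inr]
      congr 2
      simp_rw [Finset.sum_mul]
      rw [← Finset.sum_fiberwise_of_maps_to
        (g := fun k => (Sum.map id Sum.inl (src m k) : ι ⊕ (c.V ⊕ μ)))
        (fun k _ => Finset.mem_image.2 ⟨k, Finset.mem_univ k, rfl⟩)]
      refine Finset.sum_congr rfl fun u _ => Finset.sum_congr rfl fun k hk => ?_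
      rw [← (Finset.mem_filter.1 hk).2, key]

theorem extend_numEdges_le (c : SoftplusCircuit input) {μ κ : Type} [Fintype μ] [Fintype κ] (D : ℕ)
    (src : μ → κ → ι ⊕ c.V) (hsrc : ∀ m k, c.level (src m k) ≤ D) (W : μ → κ → ℝ) (b : μ → ℝ) :
    (c.extend D src hsrc W b).numEdges ≤ c.numEdges + Fintype.card μ * Fintype.card κ := by
  classical
  simp only [numEdges]
  refine (Fintype.sum_sum_type (α₁ := c.V) (α₂ := μ)
    (fun v => ((c.extend D src hsrc W b).parents v).card)).trans_le ?_
  refine add_le_add (le_of_eq ?_) ?_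
  · exact Finset.sum_congr rfl fun v _ => Finset.card_map _
  · calc _ ≤ ∑ _m : μ, Fintype.card κ :=
          Finset.sum_le_sum fun m _ => Finset.card_image_le
      _ = _ := by simp

theorem extend_signal (c : SoftplusCircuit input) {μ κ : Type} [Fintype μ] [Fintype κ] (D : ℕ)
    (src : μ → κ → ι ⊕ c.V) (hsrc : ∀ m k, c.level (src m k) ≤ D) (W : μ → κ → ℝ) (b : μ → ℝ)
    (u : ι ⊕ c.V) :
    (c.extend D src hsrc W b).signal (Sum.map id Sum.inl u) = c.signal u ∧
    (c.extend D src hsrc W b).level (Sum.map id Sum.inl u) = c.level u := by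
  cases u <;> exact ⟨rfl, rfl⟩

end SoftplusCircuit

/-! ### Approximate computability of real functions -/

/-- Circuits with at most `E` edges approximate all the functions in `F` to any accuracy, up to an
affine function of the value of a node of rank at most `D`. -/
def Computes {ι X : Type} (input : ι → X → ℝ) (F : Set (X → ℝ)) (D E : ℕ) : Prop :=
  ∀ η > (0 : ℝ), ∃ c : SoftplusCircuit input, c.numEdges ≤ E ∧
    ∀ f ∈ F, ∃ (u : ι ⊕ c.V) (α β : ℝ), c.level u ≤ D ∧ ∀ x, |α + β * c.signal u x - f x| < η

namespace Computes

variable {ι X : Type} {input : ι → X → ℝ} {F G : Set (X → ℝ)} {D E D' E' : ℕ}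

theorem mono (h : Computes input F D E) (hG : G ⊆ F) (hD : D ≤ D') (hE : E ≤ E') :
    Computes input G D' E' := by
  intro η hη
  obtain ⟨c, hc, hF⟩ := h η hη
  refine ⟨c, hc.trans hE, fun f hf => ?_⟩
  obtain ⟨u, α, β, hu, h⟩ := hF f (hG hf)
  exact ⟨u, α, β, hu.trans hD, h⟩

/-- The inputs and all the constants are available without edges. -/
theorem init : Computes input (Set.range input ∪ Set.range fun (r : ℝ) (_ : X) => r) 0 0 := by
  intro η hη
  -- The isolated neuron gives the constants a node even if there are no inputs.
  refine ⟨{ V := Unit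
            parents := fun _ => ∅
            rank := fun _ => 0
            rank_lt := by simp
            weight := fun _ _ => 0
            bias := fun _ => 0
            value := fun _ _ => softplus 0
            value_eq := by simp }, by simp [SoftplusCircuit.numEdges], ?_⟩
  rintro f (⟨i, rfl⟩ | ⟨r, rfl⟩)
  · exact ⟨Sum.inl i, 0, 1, le_rfl, fun x => by simpa [SoftplusCircuit.signal] using hη⟩
  · exact ⟨Sum.inr (), r, 0, le_rfl, fun x => by simpa using hη⟩

/-- Constants are available wherever anything is. -/
theorem union_const (h : Computes input F D E) (hF : F.Nonempty) :
    Computes input (F ∪ Set.range fun (r : ℝ) (_ : X) => r) D E := by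
  intro η hη
  obtain ⟨c, hc, h⟩ := h η hη
  refine ⟨c, hc, ?_⟩
  rintro f (hf | ⟨r, rfl⟩)
  · exact h f hf
  · obtain ⟨f, hf⟩ := hF
    obtain ⟨u, α, β, hu, -⟩ := h f hf
    exact ⟨u, r, 0, hu, fun x => by simpa using hη⟩

/-- `G` may depend on `η`: a gate parameter is fixed first, and only then the accuracy of the
circuit below it. -/
theorem of_approx (h : ∀ η > (0 : ℝ), ∃ G : Set (X → ℝ), Computes input G D E ∧
    ∀ f ∈ F, ∃ g ∈ G, ∀ x, |g x - f x| < η) : Computes input F D E := by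
  intro η hη
  obtain ⟨G, hG, hF⟩ := h (η / 2) (by positivity)
  obtain ⟨c, hc, hG⟩ := hG (η / 2) (by positivity)
  refine ⟨c, hc, fun f hf => ?_⟩
  obtain ⟨g, hg, hfg⟩ := hF f hf
  obtain ⟨u, α, β, hu, h⟩ := hG g hg
  refine ⟨u, α, β, hu, fun x => ?_⟩
  have := abs_sub_le (α + β * c.signal u x) (g x) (f x)
  linarith [hfg x, h x]

/-- A family of functions that are pointwise limits of computable ones, on a finite set. -/
theorem of_tendsto [Finite X] {μ P : Type} [Finite μ] {l : Filter P} [l.NeBot]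
    (g : P → μ → X → ℝ) (g' : μ → X → ℝ)
    (h : ∀ p, Computes input (F ∪ Set.range (g p)) D E)
    (hg : ∀ m x, Tendsto (fun p => g p m x) l (𝓝 (g' m x))) :
    Computes input (F ∪ Set.range g') D E := by
  refine of_approx fun η hη => ?_
  -- Finiteness of `μ` and `X` makes the convergence uniform.
  have h1 : ∀ᶠ p in l, ∀ m x, |g p m x - g' m x| < η := by
    rw [eventually_all]
    intro m
    rw [eventually_all]
    intro x
    exact (Metric.tendsto_nhds.1 (hg m x) η hη)
  obtain ⟨p, hp⟩ := h1.exists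
  refine ⟨_, h p, ?_⟩
  rintro f (hf | ⟨m, rfl⟩)
  · exact ⟨f, Or.inl hf, fun x => by simpa using hη⟩
  · exact ⟨_, Or.inr ⟨m, rfl⟩, hp m⟩

section Layers

variable {μ κ : Type} [Fintype μ] [Fintype κ]

/-- One more layer of softplus neurons. -/
theorem softplus_layer (hF : Computes input F D E) (h : μ → κ → X → ℝ) (hh : ∀ m k, h m k ∈ F)
    (W : μ → κ → ℝ) (b α β : μ → ℝ) :
    Computes input
      (F ∪ Set.range fun m x => α m + β m * softplus (b m + ∑ k, W m k * h m k x))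
      (D + 1) (E + Fintype.card μ * Fintype.card κ) := by
  intro η hη
  -- `T` bounds the error amplification of every new neuron. Dividing by `1 + T` rather than `T`
  -- keeps the old functions within `η` and the final inequality strict.
  set T := ∑ m, |β m| * ∑ k, |W m k| with hT
  have hT0 : 0 ≤ T := by positivity
  have hδ : 0 < η / (1 + T) := by positivity
  obtain ⟨c, hc, hcF⟩ := hF _ hδ
  choose src α' β' hsrc happ using fun m k => hcF _ (hh m k)
  -- The affine read-outs of the sources are absorbed into the weights and biases, at no cost in
  -- neurons.
  refine ⟨c.extend D src hsrc (fun m k => W m k * β' m k) (fun m => b m + ∑ k, W m k * α' m k),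
    (c.extend_numEdges_le ..).trans (by gcongr), ?_⟩
  rintro f (hf | ⟨m, rfl⟩)
  · obtain ⟨u, α, β, hu, h⟩ := hcF f hf
    refine ⟨Sum.map id Sum.inl u, α, β, ?_, fun x => ?_⟩
    · rw [(c.extend_signal ..).2]; omega
    · rw [(c.extend_signal ..).1]
      exact (h x).trans_le (div_le_self hη.le (by linarith))
  · refine ⟨Sum.inr (Sum.inr m), α m, β m, le_rfl, fun x => ?_⟩
    change |α m + β m * softplus _ - _| < η
    have h1 : |β m| * ∑ k, |W m k| ≤ T :=
      Finset.single_le_sum (f := fun m => |β m| * ∑ k, |W m k|)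
        (fun m _ => by positivity) (Finset.mem_univ m)
    have h2 : (b m + ∑ k, W m k * α' m k) + ∑ k, W m k * β' m k * c.signal (src m k) x
        - (b m + ∑ k, W m k * h m k x)
        = ∑ k, W m k * (α' m k + β' m k * c.signal (src m k) x - h m k x) := by
      rw [add_sub_add_comm, add_sub_assoc, add_comm, ← sub_eq_zero]
      simp only [mul_sub, mul_add, Finset.sum_sub_distrib, Finset.sum_add_distrib, mul_assoc]
      ring
    rw [add_sub_add_left_eq_sub, ← mul_sub, abs_mul]
    calc _ ≤ |β m| * |(b m + ∑ k, W m k * α' m k) + ∑ k, W m k * β' m k * c.signal (src m k) x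
          - (b m + ∑ k, W m k * h m k x)| := by
            exact mul_le_mul_of_nonneg_left (abs_softplus_sub_le _ _) (abs_nonneg _)
      _ ≤ |β m| * ∑ k, |W m k| * (η / (1 + T)) := by
          rw [h2]
          gcongr
          refine (Finset.abs_sum_le_sum_abs _ _).trans (Finset.sum_le_sum fun k _ => ?_)
          rw [abs_mul]
          gcongr
          exact (happ m k x).le
      _ = (|β m| * ∑ k, |W m k|) * (η / (1 + T)) := by rw [← Finset.sum_mul, mul_assoc]
      _ ≤ T * (η / (1 + T)) := by gcongr
      _ < η := by
          rw [mul_div_assoc', div_lt_iff₀ (by positivity)]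
          nlinarith

variable [Finite X]

/-- Affine combinations. -/
theorem affine_layer (hF : Computes input F D E) (h : μ → κ → X → ℝ) (hh : ∀ m k, h m k ∈ F)
    (W : μ → κ → ℝ) (b : μ → ℝ) :
    Computes input (F ∪ Set.range fun m x => b m + ∑ k, W m k * h m k x)
      (D + 1) (E + Fintype.card μ * Fintype.card κ) := by
  refine of_tendsto (l := atTop)
    (fun (B : ℝ) m x => -B + 1 * softplus ((B + b m) + ∑ k, W m k * h m k x)) _
    (fun B => hF.softplus_layer h hh W (fun m => B + b m) (fun _ => -B) (fun _ => 1))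
    fun m x => ?_
  simpa only [add_assoc] using tendsto_softplus_shift (b m + ∑ k, W m k * h m k x)

/-- Products. -/
theorem mul_layer (hF : Computes input F D E) (p q : μ → X → ℝ) (hp : ∀ m, p m ∈ F)
    (hq : ∀ m, q m ∈ F) :
    Computes input (F ∪ Set.range fun m x => p m x * q m x)
      (D + 3) (E + 7 * Fintype.card μ) := by
  refine of_tendsto (l := 𝓝[≠] (0 : ℝ)) (fun (δ : ℝ) m x => 2 / δ ^ 2 *
    softplus (δ * p m x + δ * q m x) + -2 / δ ^ 2 * softplus (δ * p m x + -δ * q m x)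
      + -2 / δ * q m x) _ (fun δ => ?_) fun m x => tendsto_product_gate _ _
  -- Per product, two neurons with 2 edges each and a combination with 3 make 7 edges.
  have h1 := hF.softplus_layer (fun m => ![p m, q m])
    (fun m k => by fin_cases k; exacts [hp m, hq m]) (fun _ => ![δ, δ]) 0 0 1
  have h2 := h1.softplus_layer (fun m => ![p m, q m])
    (fun m k => by fin_cases k; exacts [Or.inl (hp m), Or.inl (hq m)]) (fun _ => ![δ, -δ]) 0 0 1
  have h3 := h2.affine_layer (fun m => ![fun x => softplus (δ * p m x + δ * q m x),
    fun x => softplus (δ * p m x + -δ * q m x), q m])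
    (fun m k => by
      fin_cases k
      · exact Or.inl (Or.inr ⟨m, by simp⟩)
      · exact Or.inr ⟨m, by simp⟩
      · exact Or.inl (Or.inl (hq m))) (fun _ => ![2 / δ ^ 2, -2 / δ ^ 2, -2 / δ]) 0
  refine h3.mono ?_ le_rfl (by simp; omega)
  rintro f (hf | ⟨m, rfl⟩)
  · exact Or.inl (Or.inl (Or.inl hf))
  · exact Or.inr ⟨m, by funext x; simp [Fin.sum_univ_three]⟩

/-- The step function. -/
theorem step_layer (hF : Computes input F D E) {t : X → ℝ} (ht : t ∈ F) :
    Computes input (F ∪ {fun x => if 0 ≤ t x then 1 else 0}) (D + 3) (E + 4) := by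
  have := of_tendsto (input := input) (F := F) (D := D + 3) (E := E + 4) (l := atTop)
    (fun (B : ℝ) (_ : Unit) x => 1 * softplus (B + 1 + B ^ 2 * t x)
      + -1 * softplus (B + B ^ 2 * t x)) (fun _ x => if 0 ≤ t x then 1 else 0) (fun B => ?_)
    fun m x => tendsto_step_gate _
  · simpa only [Set.range_const] using this
  have h1 := hF.softplus_layer (μ := Unit) (κ := Unit) (fun _ _ => t) (fun _ _ => ht)
    (fun _ _ => B ^ 2) (fun _ => B + 1) 0 1
  have h2 := h1.softplus_layer (μ := Unit) (κ := Unit) (fun _ _ => t) (fun _ _ => Or.inl ht)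
    (fun _ _ => B ^ 2) (fun _ => B) 0 1
  have h3 := h2.affine_layer (μ := Unit) (fun _ => ![fun x => softplus (B + 1 + B ^ 2 * t x),
    fun x => softplus (B + B ^ 2 * t x)])
    (fun m k => by
      fin_cases k
      · exact Or.inl (Or.inr ⟨(), by simp⟩)
      · exact Or.inr ⟨(), by simp⟩) (fun _ => ![1, -1]) 0
  refine h3.mono ?_ le_rfl (by simp)
  rintro f (hf | ⟨m, rfl⟩)
  · exact Or.inl (Or.inl (Or.inl hf))
  · exact Or.inr ⟨(), by funext x; simp [Fin.sum_univ_two]⟩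

end Layers

end Computes

/-! ### Complex-valued functions -/

/-- The real part of `z` for `false`, the imaginary part for `true`. -/
def complexPart (i : Bool) (z : ℂ) : ℝ := bif i then z.im else z.re

/-- The real and imaginary parts of complex functions. -/
def complexParts {X : Type} (F : Set (X → ℂ)) : Set (X → ℝ) :=
  {g | ∃ f ∈ F, ∃ i, g = fun x => complexPart i (f x)}

/-- Circuits with at most `E` edges and rank at most `D` approximate the real and imaginary parts of
all the functions in `F`. -/
def ComputesComplex {ι X : Type} (input : ι → X → ℝ) (F : Set (X → ℂ)) (D E : ℕ) : Prop :=
  Computes input (complexParts F) D E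

theorem complexParts_mono {X : Type} {F G : Set (X → ℂ)} (h : F ⊆ G) :
    complexParts F ⊆ complexParts G := by
  rintro _ ⟨f, hf, i, rfl⟩
  exact ⟨f, h hf, i, rfl⟩

theorem complexParts_union_range {X μ : Type} (F : Set (X → ℂ)) (g : μ → X → ℂ) :
    complexParts (F ∪ Set.range g) =
      complexParts F ∪ Set.range fun (m : μ × Bool) x => complexPart m.2 (g m.1 x) := by
  ext f
  constructor
  · rintro ⟨f, hf | ⟨m, rfl⟩, i, rfl⟩
    · exact Or.inl ⟨f, hf, i, rfl⟩
    · exact Or.inr ⟨(m, i), rfl⟩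
  · rintro (⟨f, hf, i, rfl⟩ | ⟨⟨m, i⟩, rfl⟩)
    · exact ⟨f, Or.inl hf, i, rfl⟩
    · exact ⟨_, Or.inr ⟨m, rfl⟩, i, rfl⟩

namespace ComputesComplex

variable {ι X : Type} {input : ι → X → ℝ} {F G : Set (X → ℂ)} {D E D' E' : ℕ}

theorem mono (h : ComputesComplex input F D E) (hG : G ⊆ F) (hD : D ≤ D') (hE : E ≤ E') :
    ComputesComplex input G D' E' :=
  Computes.mono h (complexParts_mono hG) hD hE

theorem init : ComputesComplex input
    ((Set.range fun i x => (input i x : ℂ)) ∪ Set.range fun (r : ℂ) (_ : X) => r) 0 0 := by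
  refine Computes.init.mono ?_ le_rfl le_rfl
  rintro _ ⟨_, ⟨i, rfl⟩ | ⟨r, rfl⟩, (_ | _), rfl⟩
  · exact Or.inl ⟨i, rfl⟩
  · exact Or.inr ⟨0, rfl⟩
  · exact Or.inr ⟨r.re, rfl⟩
  · exact Or.inr ⟨r.im, rfl⟩

section Layers

variable [Finite X] {μ κ : Type} [Fintype μ] [Fintype κ]

theorem affine_layer (hF : ComputesComplex input F D E) (h : μ → κ → X → ℂ)
    (hh : ∀ m k, h m k ∈ F) (W : μ → κ → ℂ) (b : μ → ℂ) :
    ComputesComplex input (F ∪ Set.range fun m x => b m + ∑ k, W m k * h m k x)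
      (D + 1) (E + 4 * (Fintype.card μ * Fintype.card κ)) := by
  have := Computes.affine_layer hF (μ := μ × Bool) (κ := κ × Bool)
    (fun m k x => complexPart k.2 (h m.1 k.1 x)) (fun m k => ⟨_, hh m.1 k.1, k.2, rfl⟩)
    -- The real 2 × 2 matrix of multiplication by `W`: `m.2` selects the output part, `k.2` the
    -- input part.
    (fun m k => bif m.2 then (bif k.2 then (W m.1 k.1).re else (W m.1 k.1).im)
      else (bif k.2 then -(W m.1 k.1).im else (W m.1 k.1).re)) (fun m => complexPart m.2 (b m.1))
  rw [ComputesComplex, complexParts_union_range]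
  refine this.mono (Set.union_subset_union_right _ ?_) le_rfl ?_
  · rintro _ ⟨⟨m, i⟩, rfl⟩
    refine ⟨(m, i), ?_⟩
    funext x
    cases i
    · simp [complexPart, Fintype.sum_prod_type, sub_eq_add_neg, add_comm]
    · simp [complexPart, Fintype.sum_prod_type]
  · simp only [Fintype.card_prod, Fintype.card_bool]
    exact le_of_eq (by ring)

/-- A single affine combination of two functions. -/
theorem affine_two (hF : ComputesComplex input F D E) {f g : X → ℂ} (hf : f ∈ F) (hg : g ∈ F)
    (u v b : ℂ) : ComputesComplex input (F ∪ {fun x => b + (u * f x + v * g x)})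
      (D + 1) (E + 8) := by
  have := hF.affine_layer (μ := Unit) (fun _ => ![f, g])
    (fun m k => by fin_cases k; exacts [hf, hg]) (fun _ => ![u, v]) (fun _ => b)
  simpa [Fin.sum_univ_two, Set.range_const] using this

theorem mul_layer (hF : ComputesComplex input F D E) (p q : μ → X → ℂ) (hp : ∀ m, p m ∈ F)
    (hq : ∀ m, q m ∈ F) :
    ComputesComplex input (F ∪ Set.range fun m x => p m x * q m x)
      (D + 4) (E + 32 * Fintype.card μ) := by
  have h1 := Computes.mul_layer hF (μ := μ × Bool × Bool) (fun m x => complexPart m.2.1 (p m.1 x))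
    (fun m x => complexPart m.2.2 (q m.1 x)) (fun m => ⟨_, hp m.1, _, rfl⟩)
    (fun m => ⟨_, hq m.1, _, rfl⟩)
  -- The real part pairs equal parts and the imaginary part opposite ones, whence the `xor`; the
  -- only minus sign is that of `im * im`.
  have h2 := h1.affine_layer (μ := μ × Bool) (κ := Bool)
    (fun m k x => complexPart k (p m.1 x) * complexPart (xor k m.2) (q m.1 x))
    (fun m k => Or.inr ⟨(m.1, k, xor k m.2), rfl⟩)
    (fun m k => bif (!m.2 && k) then -1 else 1) 0
  rw [ComputesComplex, complexParts_union_range]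
  refine h2.mono (Set.union_subset_union Set.subset_union_left ?_) le_rfl ?_
  · rintro _ ⟨⟨m, i⟩, rfl⟩
    refine ⟨(m, i), ?_⟩
    funext x
    cases i <;> simp [complexPart] <;> ring
  · simp only [Fintype.card_prod, Fintype.card_bool]
    omega

theorem mul_single (hF : ComputesComplex input F D E) {f g : X → ℂ} (hf : f ∈ F) (hg : g ∈ F) :
    ComputesComplex input (F ∪ {fun x => f x * g x}) (D + 4) (E + 32) := by
  have := hF.mul_layer (μ := Unit) (fun _ => f) (fun _ => g) (fun _ => hf) (fun _ => hg)
  simpa [Set.range_const] using this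

/-- The square of the modulus, less one. -/
theorem normSq_layer (hF : ComputesComplex input F D E) {f : X → ℂ} (hf : f ∈ F) :
    ComputesComplex input (F ∪ {fun x => ((Complex.normSq (f x) - 1 : ℝ) : ℂ)})
      (D + 4) (E + 16) := by
  have h1 := Computes.mul_layer hF (μ := Bool) (fun i x => complexPart i (f x))
    (fun i x => complexPart i (f x)) (fun i => ⟨_, hf, _, rfl⟩) (fun i => ⟨_, hf, _, rfl⟩)
  have h2 := h1.affine_layer (μ := Unit) (κ := Bool)
    (fun _ i x => complexPart i (f x) * complexPart i (f x)) (fun _ i => Or.inr ⟨i, rfl⟩)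
    (fun _ _ => 1) (fun _ => -1)
  have h3 := h2.union_const ⟨_, Or.inr ⟨(), rfl⟩⟩
  refine h3.mono ?_ le_rfl (by simp)
  rintro _ ⟨g, hg | rfl, i, rfl⟩
  · exact Or.inl (Or.inl (Or.inl ⟨g, hg, i, rfl⟩))
  · cases i
    · refine Or.inl (Or.inr ⟨(), ?_⟩)
      funext x
      simp [complexPart, Complex.normSq_apply]
      ring
    · exact Or.inr ⟨0, by funext x; simp [complexPart]⟩

theorem step_layer (hF : ComputesComplex input F D E) {t : X → ℂ} (ht : t ∈ F) :
    ComputesComplex input (F ∪ {fun x => if 0 ≤ (t x).re then 1 else 0}) (D + 3) (E + 4) := by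
  have h1 := Computes.step_layer hF (t := fun x => (t x).re) ⟨t, ht, false, rfl⟩
  have h2 := h1.union_const ⟨_, Or.inr rfl⟩
  refine h2.mono ?_ le_rfl le_rfl
  rintro _ ⟨g, hg | rfl, i, rfl⟩
  · exact Or.inl (Or.inl ⟨g, hg, i, rfl⟩)
  · cases i
    · refine Or.inl (Or.inr ?_)
      funext x
      simp only [complexPart, cond_false]
      split_ifs <;> simp
    · refine Or.inr ⟨0, ?_⟩
      funext x
      simp only [complexPart, cond_true]
      split_ifs <;> simp

/-! ### The logarithm by binary search -/

/-- If `z = exp ℓ`, a step of a binary search for `ℓ`: subtract `c` from `ℓ` or add it to `ℓ`,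
depending on the sign of a test function, and keep the account. -/
theorem search_step {ℓ acc t : X → ℂ}
    (hF : ComputesComplex input {fun x => Complex.exp (ℓ x), acc, t} D E) (c : ℂ) :
    ComputesComplex input {fun x => Complex.exp (ℓ x - if 0 ≤ (t x).re then c else -c),
      fun x => acc x + if 0 ≤ (t x).re then c else -c} (D + 9) (E + 52) := by
  have h1 := hF.step_layer (t := t) (by simp)
  set σ : X → ℂ := fun x => if 0 ≤ (t x).re then 1 else 0 with hσ
  -- As `σ` is `0` or `1`, the factor `exp (∓c)` is affine in `σ`, so one multiplication covers both
  -- cases.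
  have h2 := h1.affine_two (f := σ) (g := σ) (by simp) (by simp)
    (Complex.exp (-c) - Complex.exp c) 0 (Complex.exp c)
  have h3 := h2.mul_single (f := fun x => Complex.exp (ℓ x)) (by simp) (Or.inr rfl)
  have h4 := h3.affine_two (f := acc) (g := σ) (by simp) (by simp) 1 (2 * c) (-c)
  refine h4.mono ?_ le_rfl le_rfl
  rintro f (rfl | rfl)
  · refine Or.inl (Or.inr ?_)
    funext x
    simp only [hσ]
    split_ifs <;> simp [sub_eq_add_neg, Complex.exp_add]
  · refine Or.inr ?_
    funext x
    simp only [hσ]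
    split_ifs <;> ring

/-- Binary search for the real part of `ℓ`. -/
theorem search_re {ℓ acc : X → ℂ} (hF : ComputesComplex input {fun x => Complex.exp (ℓ x), acc} D E)
    {R : ℝ} (hR : ∀ x, |(ℓ x).re| ≤ R) (n : ℕ) :
    ∃ ℓ' acc' : X → ℂ, (∀ x, ℓ' x + acc' x = ℓ x + acc x) ∧ (∀ x, |(ℓ' x).re| ≤ R / 2 ^ n) ∧
      (∀ x, (ℓ' x).im = (ℓ x).im) ∧
      ComputesComplex input {fun x => Complex.exp (ℓ' x), acc'} (D + 13 * n) (E + 68 * n) := by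
  induction n with
  | zero => exact ⟨ℓ, acc, fun _ => rfl, by simpa using hR, fun _ => rfl, hF⟩
  | succ n ih =>
    obtain ⟨ℓ', acc', h1, h2, h3, h4⟩ := ih
    -- `Re ℓ'` lies in `[-2c, 2c]`; a shift by `c` towards the origin halves this interval.
    set c : ℝ := R / 2 ^ (n + 1) with hc
    have hc2 : R / 2 ^ n = 2 * c := by rw [hc, pow_succ]; field_simp
    have h5 := (h4.normSq_layer (f := fun x => Complex.exp (ℓ' x)) (by simp)).mono
      (G := {fun x => Complex.exp (ℓ' x), acc',
        fun x => ((Complex.normSq (Complex.exp (ℓ' x)) - 1 : ℝ) : ℂ)})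
      (by intro f; simp only [Set.mem_union, Set.mem_insert_iff, Set.mem_singleton_iff]; tauto)
      le_rfl le_rfl
    have key : ∀ x, 0 ≤ ((Complex.normSq (Complex.exp (ℓ' x)) - 1 : ℝ) : ℂ).re ↔
        0 ≤ (ℓ' x).re := by
      intro x
      rw [Complex.ofReal_re, Complex.normSq_eq_norm_sq, Complex.norm_exp, sub_nonneg,
        one_le_sq_iff₀ (by positivity), Real.one_le_exp_iff]
    refine ⟨_, _, fun x => ?_, fun x => ?_, fun x => ?_,
      (h5.search_step c).mono subset_rfl (by omega) (by omega)⟩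
    · rw [← h1 x]; ring
    · have := h2 x
      rw [hc2, abs_le] at this
      simp only [key]
      split_ifs with h
      · simp only [Complex.sub_re, Complex.ofReal_re]
        rw [abs_le]; constructor <;> linarith
      · simp only [Complex.sub_re, Complex.neg_re, Complex.ofReal_re]
        rw [abs_le]; constructor <;> linarith
    · rw [← h3 x]
      split_ifs <;> simp

/-- Binary search for the imaginary part of `ℓ`. -/
theorem search_im {ℓ acc : X → ℂ} (hF : ComputesComplex input {fun x => Complex.exp (ℓ x), acc} D E)
    (h0 : ∀ x, -Real.pi < (ℓ x).im) (h0' : ∀ x, (ℓ x).im ≤ Real.pi) (n : ℕ) :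
    ∃ ℓ' acc' : X → ℂ, (∀ x, ℓ' x + acc' x = ℓ x + acc x) ∧ (∀ x, (ℓ' x).re = (ℓ x).re) ∧
      (∀ x, |(ℓ' x).im| ≤ Real.pi / 2 ^ n) ∧ (∀ x, -Real.pi < (ℓ' x).im) ∧
      ComputesComplex input {fun x => Complex.exp (ℓ' x), acc'} (D + 10 * n) (E + 60 * n) := by
  induction n with
  | zero =>
    exact ⟨ℓ, acc, fun _ => rfl, fun _ => rfl, fun x => by
      simpa [abs_le] using ⟨(h0 x).le, h0' x⟩, h0, hF⟩
  | succ n ih =>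
    obtain ⟨ℓ', acc', h1, h2, h3, h6, h4⟩ := ih
    set c : ℝ := Real.pi / 2 ^ (n + 1) with hc
    have hc2 : Real.pi / 2 ^ n = 2 * c := by rw [hc, pow_succ]; field_simp
    have hpi : 2 * c ≤ Real.pi := by
      rw [← hc2]; exact div_le_self Real.pi_pos.le (one_le_pow₀ (by norm_num))
    have hc0 : 0 < c := by positivity
    have h5 := (h4.affine_two (f := fun x => Complex.exp (ℓ' x)) (g := acc') (by simp) (by simp)
      (-Complex.I) 0 0).mono
      (G := {fun x => Complex.exp (ℓ' x), acc',
        fun x => 0 + (-Complex.I * Complex.exp (ℓ' x) + 0 * acc' x)})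
      (by intro f; simp only [Set.mem_union, Set.mem_insert_iff, Set.mem_singleton_iff]; tauto)
      le_rfl le_rfl
    -- The sine has the sign of its argument on `(-π, π]`, with `π` counted as nonnegative. At `-π`
    -- the test would fail, so the strict lower bound is carried through the induction.
    have key : ∀ x, 0 ≤ (0 + (-Complex.I * Complex.exp (ℓ' x) + 0 * acc' x)).re ↔
        0 ≤ (ℓ' x).im := by
      intro x
      have e : (0 + (-Complex.I * Complex.exp (ℓ' x) + 0 * acc' x)).re =
        Real.exp (ℓ' x).re * Real.sin (ℓ' x).im := by simp [Complex.exp_im]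
      rw [e, mul_nonneg_iff_of_pos_left (Real.exp_pos _)]
      constructor
      · intro h
        by_contra! h'
        exact absurd h (not_le.2 (Real.sin_neg_of_neg_of_neg_pi_lt h' (h6 x)))
      · intro h
        exact Real.sin_nonneg_of_nonneg_of_le_pi h
          ((le_abs_self _).trans ((h3 x).trans (hc2.trans_le hpi)))
    have hb : ∀ x, |(ℓ' x - if 0 ≤ (ℓ' x).im then (c * Complex.I) else -(c * Complex.I)).im| ≤
        c := by
      intro x
      have := h3 x
      rw [hc2, abs_le] at this
      split_ifs with h
      · simp only [Complex.sub_im, Complex.im_ofReal_mul, Complex.I_im]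
        rw [abs_le]; constructor <;> linarith
      · simp only [Complex.sub_im, Complex.neg_im, Complex.im_ofReal_mul, Complex.I_im]
        rw [abs_le]; constructor <;> linarith
    have h7 := h5.search_step (c * Complex.I)
    simp only [key] at h7
    refine ⟨_, _, fun x => ?_, fun x => ?_, hb, fun x => ?_,
      h7.mono subset_rfl (by omega) (by omega)⟩
    · rw [← h1 x]; ring
    · rw [← h2 x]
      split_ifs <;> simp
    · have := (abs_le.1 (hb x)).1
      linarith

/-- The principal branch of the logarithm of a function whose modulus is between `exp (-R)` and
`exp R`. -/
theorem exists_log_approx {Ψ : X → ℂ} (hF : ComputesComplex input {Ψ} D E) (hΨ : ∀ x, Ψ x ≠ 0)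
    {R : ℝ} (hR : ∀ x, |Real.log ‖Ψ x‖| ≤ R) (n : ℕ) :
    ∃ acc : X → ℂ, (∀ x, ‖acc x - Complex.log (Ψ x)‖ ≤ (R + Real.pi) / 2 ^ n) ∧
      ComputesComplex input {acc} (D + 23 * n) (E + 128 * n) := by
  -- The search starts from `ℓ = log Ψ` and `acc = 0`; `ℓ` itself is never computed.
  have h0 : ComputesComplex input {fun x => Complex.exp (Complex.log (Ψ x)), fun _ => 0} D E := by
    refine (Computes.union_const hF ⟨_, Ψ, rfl, false, rfl⟩).mono ?_ le_rfl le_rfl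
    rintro _ ⟨_, rfl | rfl, i, rfl⟩
    · exact Or.inl ⟨Ψ, rfl, i, by funext x; simp only [Complex.exp_log (hΨ x)]⟩
    · exact Or.inr ⟨0, by funext x; cases i <;> simp [complexPart]⟩
  obtain ⟨ℓ₁, acc₁, h1, h2, h3, h4⟩ := h0.search_re (R := R)
    (fun x => by simpa [Complex.log_re] using hR x) n
  obtain ⟨ℓ₂, acc₂, h5, h6, h7, -, h8⟩ := h4.search_im
    (fun x => by rw [h3]; exact Complex.neg_pi_lt_log_im _)
    (fun x => by rw [h3]; exact Complex.log_im_le_pi _) n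
  refine ⟨acc₂, fun x => ?_, h8.mono (by simp) (by omega) (by omega)⟩
  have e : acc₂ x - Complex.log (Ψ x) = -ℓ₂ x := by
    have := (h5 x).trans (h1 x)
    linear_combination this
  rw [e, norm_neg, add_div]
  refine (Complex.norm_le_abs_re_add_abs_im _).trans (add_le_add ?_ (h7 x))
  rw [h6]; exact h2 x

end Layers

end ComputesComplex

/-! ### From circuits to networks -/

open Classical in
/-- Two functions that circuits compute are the outputs of a network with linear roots. -/
theorem Computes.exists_neuralNet {ι X : Type} {input : ι → X → ℝ} {F : Set (X → ℝ)} {D E : ℕ}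
    (hF : Computes input F D E) (g : Fin 2 → X → ℝ) (hg : ∀ j, g j ∈ F) {η : ℝ} (hη : 0 < η) :
    ∃ net : NeuralNet ι, net.depth ≤ D + 1 ∧ net.numEdges ≤ E + 2 ∧
      ∀ j x, |net.output (fun i => input i x) j - g j x| < η := by
  obtain ⟨c, hc, h⟩ := hF η hη
  choose u α β hu h using fun j => h _ (hg j)
  let e : ι ⊕ c.V ↪ ι ⊕ (c.V ⊕ Fin 2) :=
    (Function.Embedding.refl ι).sumMap Function.Embedding.inl
  let rank : c.V ⊕ Fin 2 → ℕ := Sum.elim c.rank fun _ => D + 1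
  -- The roots are fresh linear neurons that perform the affine read-out. They are sinks, and
  -- distinct even if `u 0 = u 1`.
  let parents : c.V ⊕ Fin 2 → Finset (ι ⊕ (c.V ⊕ Fin 2)) :=
    Sum.elim (fun v => (c.parents v).map e) fun j => {e (u j)}
  have hrank : ∀ v, ∀ w ∈ parents v, Sum.elim (fun _ => 0) rank w < rank v := by
    rintro (v | j) w hw
    · obtain ⟨w', hw', rfl⟩ := Finset.mem_map.1 hw
      have := c.rank_lt v w' hw'
      cases w' <;> simpa [rank, e] using this
    · obtain rfl := Finset.mem_singleton.1 hw
      have := hu j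
      rw [SoftplusCircuit.level] at this
      generalize u j = w at this
      cases w
      · simp [rank, e]
      · simpa [rank, e, Nat.lt_succ_iff] using this
  let net : NeuralNet ι :=
    { V := c.V ⊕ Fin 2
      parents := parents
      acyclic := Subrelation.wf (r := InvImage (· < ·) rank)
        (fun {w v} hw => hrank v (Sum.inr w) hw) (InvImage.wf _ wellFounded_lt)
      weight := fun w v => Sum.elim
        (fun v => Sum.elim (fun i => c.weight (Sum.inl i) v)
          (Sum.elim (fun w => c.weight (Sum.inr w) v) fun _ => 0) w)
        (fun j => β j) v
      bias := Sum.elim c.bias α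
      root := Sum.inr
      root_injective := Sum.inr_injective
      root_sink := by
        rintro j (v | j') hw
        · obtain ⟨w, -, hw⟩ := Finset.mem_map.1 hw
          cases w <;> simp [e] at hw
        · have hw := Finset.mem_singleton.1 hw
          revert hw
          cases u j' <;> simp [e]
      linearRoots := Set.univ }
  have hval : ∀ x v, net.value (fun i => input i x) (Sum.inl v) = c.value v x := by
    intro x v
    induction hn : c.rank v using Nat.strong_induction_on generalizing v with
    | _ n ih =>
      rw [NeuralNet.value_eq, c.value_eq]
      have hact : ∀ t, net.activation (Sum.inl v) t = softplus t := fun t => by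
        rw [NeuralNet.activation, if_neg]
        rintro ⟨j, -, hj⟩
        exact Sum.inr_ne_inl hj
      rw [hact]
      change softplus (c.bias v + ∑ w ∈ (c.parents v).map e, _) = _
      rw [Finset.sum_map]
      congr 2
      refine Finset.sum_congr rfl fun w hw => ?_
      cases w with
      | inl i => rfl
      | inr w =>
        have hlt := c.rank_lt v _ hw
        change c.weight (Sum.inr w) v * net.value (fun i => input i x) (Sum.inl w) = _
        rw [ih _ (hn ▸ hlt) w rfl]
        rfl
  have hpath : ∀ i v n, net.HasPath i v n → n ≤ rank v := by
    intro i v n p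
    induction p with
    | first h => have := hrank _ _ h; simp at this; omega
    | step p h ih => have := hrank _ _ h; simp at this; omega
  refine ⟨net, ?_, ?_, fun j x => ?_⟩
  · rcases Set.eq_empty_or_nonempty {n | ∃ i j, net.HasPath i (net.root j) n} with h0 | h0
    · rw [NeuralNet.depth, h0]; simp
    · refine csSup_le h0 ?_
      rintro n ⟨i, j, p⟩
      exact hpath i _ n p
  · refine (Fintype.sum_sum_type (α₁ := c.V) (α₂ := Fin 2) fun v => (parents v).card).trans_le ?_
    refine add_le_add ((Finset.sum_congr rfl fun v _ => Finset.card_map _).trans_le hc) ?_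
    simp [parents]
  · have : net.output (fun i => input i x) j = α j + β j * c.signal (u j) x := by
      rw [NeuralNet.output, NeuralNet.value_eq, NeuralNet.activation,
        if_pos ⟨j, Set.mem_univ _, rfl⟩]
      change α j + ∑ w ∈ {e (u j)}, _ = _
      rw [Finset.sum_singleton]
      congr 1
      cases hw : u j with
      | inl i => rfl
      | inr w =>
        change β j * net.value (fun i => input i x) (Sum.inl w) = _
        rw [hval]; rfl
    rw [this]
    exact h j x

/-! ### Matrix products -/

namespace ComputesComplex

variable {ι X : Type} {input : ι → X → ℝ} {F : Set (X → ℂ)} {D E : ℕ} [Finite X]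

/-- Sums of products. -/
theorem sum_mul_layer {μ κ : Type} [Fintype μ] [Fintype κ] (hF : ComputesComplex input F D E)
    (p q : μ → κ → X → ℂ) (hp : ∀ m k, p m k ∈ F) (hq : ∀ m k, q m k ∈ F) :
    ComputesComplex input (F ∪ Set.range fun m x => ∑ k, p m k x * q m k x)
      (D + 5) (E + 36 * (Fintype.card μ * Fintype.card κ)) := by
  have h1 := hF.mul_layer (μ := μ × κ) (fun m => p m.1 m.2) (fun m => q m.1 m.2)
    (fun m => hp _ _) (fun m => hq _ _)
  have h2 := h1.affine_layer (fun m k x => p m k x * q m k x)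
    (fun m k => Or.inr ⟨(m, k), rfl⟩) (fun _ _ => 1) 0
  refine h2.mono ?_ le_rfl ?_
  · rintro _ (hf | ⟨m, rfl⟩)
    · exact Or.inl (Or.inl hf)
    · exact Or.inr ⟨m, by funext x; simp⟩
  · rw [Fintype.card_prod]; omega

variable {χ : ℕ}

/-- A row vector times a product of matrices, one matrix after the other. -/
theorem vecMul_prod {N : ℕ} {M : ℕ → X → Matrix (Fin χ) (Fin χ) ℂ} {l : Fin χ → ℂ}
    (hF : ComputesComplex input
      ((Set.range fun (p : Fin N × Fin χ × Fin χ) x => M p.1 x p.2.1 p.2.2) ∪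
        Set.range fun α _ => l α) D E) {n : ℕ} (hn : n ≤ N) :
    ComputesComplex input
      ((Set.range fun (p : Fin N × Fin χ × Fin χ) x => M p.1 x p.2.1 p.2.2) ∪
        Set.range fun α x => (l ᵥ* ((List.range n).map (M · x)).prod) α)
      (D + 5 * n) (E + 36 * (n * χ ^ 2)) := by
  induction n with
  | zero => simpa using hF
  | succ n ih =>
    have h1 := (ih (by omega)).sum_mul_layer (μ := Fin χ)
      (fun _ α x => (l ᵥ* ((List.range n).map (M · x)).prod) α) (fun β α x => M n x α β)
      (fun _ α => Or.inr ⟨α, rfl⟩) (fun β α => Or.inl ⟨(⟨n, by omega⟩, α, β), rfl⟩)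
    refine h1.mono ?_ (by omega) (by simp only [Fintype.card_fin]; apply le_of_eq; ring)
    rintro _ (hf | ⟨β, rfl⟩)
    · exact Or.inl (Or.inl hf)
    · refine Or.inr ⟨β, ?_⟩
      funext x
      simp only [List.range_succ, List.map_append, List.prod_append, ← Matrix.vecMul_vecMul]
      simp [Matrix.vecMul, dotProduct]

end ComputesComplex

theorem List.prod_map_range_two_mul {M : Type} [Monoid M] (f : ℕ → M) (n : ℕ) :
    ((List.range (2 * n)).map f).prod =
      ((List.range n).map fun j => f (2 * j) * f (2 * j + 1)).prod := by
  induction n with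
  | zero => simp
  | succ n ih =>
    rw [mul_add, mul_one, List.range_succ, List.range_succ, List.range_succ]
    simp [ih]

namespace ComputesComplex

variable {ι X : Type} {input : ι → X → ℝ} {F : Set (X → ℂ)} {D E : ℕ} [Finite X] {χ : ℕ}

/-- A product of matrices, in parallel steps that multiply neighbours in disjoint pairs. -/
theorem prod_pairwise (k : ℕ) {M : ℕ → X → Matrix (Fin χ) (Fin χ) ℂ}
    (hF : ComputesComplex input
      (Set.range fun (p : Fin (2 ^ k) × Fin χ × Fin χ) x => M p.1 x p.2.1 p.2.2) D E) :
    ComputesComplex input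
      (Set.range fun (p : Fin χ × Fin χ) x => ((List.range (2 ^ k)).map (M · x)).prod p.1 p.2)
      (D + 5 * k) (E + 36 * (2 ^ k * χ ^ 3)) := by
  induction k generalizing M D E with
  | zero =>
    refine hF.mono ?_ (by omega) (by omega)
    rintro _ ⟨p, rfl⟩
    exact ⟨(0, p), by simp⟩
  | succ k ih =>
    have h1 := hF.sum_mul_layer (μ := Fin (2 ^ k) × Fin χ × Fin χ)
      (fun p γ x => M (2 * p.1) x p.2.1 γ) (fun p γ x => M (2 * p.1 + 1) x γ p.2.2)
      (fun p γ => ⟨(⟨2 * p.1, by have := p.1.2; rw [pow_succ]; omega⟩, p.2.1, γ), rfl⟩)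
      (fun p γ => ⟨(⟨2 * p.1 + 1, by have := p.1.2; rw [pow_succ]; omega⟩, γ, p.2.2), rfl⟩)
    have h2 := ih (M := fun j x => M (2 * j) x * M (2 * j + 1) x)
      (h1.mono (by
        rintro _ ⟨p, rfl⟩
        exact Or.inr ⟨p, by funext x; simp [Matrix.mul_apply]⟩) le_rfl le_rfl)
    refine h2.mono ?_ (by omega) ?_
    · rintro _ ⟨p, rfl⟩
      refine ⟨p, ?_⟩
      funext x
      simp only [pow_succ' 2 k, List.prod_map_range_two_mul]
    -- The first step costs `36 * (2 ^ k * χ ^ 3)` edges, and the induction hypothesis allows as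
    -- much again for the rest.
    · simp only [Fintype.card_fin, Fintype.card_prod]
      apply le_of_eq; ring

end ComputesComplex

/-! ### Contraction circuits and size of the amplitudes -/

namespace MPS

variable {N d χ : ℕ}

/-- The inputs of a network for a matrix product state. -/
def indicator (N d : ℕ) (p : Fin N × Fin d) (s : Fin N → Fin d) : ℝ :=
  if s p.1 = p.2 then 1 else 0

/-- The matrix selected by a configuration at a site, continued by the identity matrix. -/
noncomputable def siteMatrix (A : MPS N d χ) (j : ℕ) (s : Fin N → Fin d) :
    Matrix (Fin χ) (Fin χ) ℂ :=
  if h : j < N then A.site ⟨j, h⟩ (s ⟨j, h⟩) else 1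

theorem matrices_eq (A : MPS N d χ) (s : Fin N → Fin d) :
    A.matrices s = (List.range N).map (A.siteMatrix · s) := by
  refine List.ext_getElem (by simp [matrices]) fun j h1 h2 => ?_
  have hj : j < N := by simpa using h2
  simp [matrices, siteMatrix, hj]

/-- Padding with identity matrices to a power of two makes `prod_pairwise` applicable to every `N`.
-/
theorem prod_matrices (A : MPS N d χ) (s : Fin N → Fin d) {n : ℕ} (hn : N ≤ n) :
    ((List.range n).map (A.siteMatrix · s)).prod = (A.matrices s).prod := by
  induction n, hn using Nat.le_induction with
  | base => rw [matrices_eq]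
  | succ n hn ih =>
    rw [List.range_succ, List.map_append, List.prod_append, ih]
    simp [siteMatrix, not_lt.2 hn]

/-- The entries of all the selected matrices are linear in the inputs. -/
theorem computes_siteMatrix (A : MPS N d χ) :
    ComputesComplex (indicator N d)
      ((Set.range fun (p : ℕ × Fin χ × Fin χ) s => A.siteMatrix p.1 s p.2.1 p.2.2) ∪
        Set.range fun (r : ℂ) _ => r) 1 (4 * (N * d * χ ^ 2)) := by
  have h := ComputesComplex.init (input := indicator N d).affine_layer (μ := Fin N × Fin χ × Fin χ)
    (κ := Fin d) (fun m k s => (indicator N d (m.1, k) s : ℂ)) (fun m k => Or.inl ⟨(m.1, k), rfl⟩)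
    (fun m k => A.site m.1 k m.2.1 m.2.2) 0
  refine h.mono ?_ le_rfl (by simp only [Fintype.card_prod, Fintype.card_fin]; apply le_of_eq; ring)
  rintro _ (⟨⟨j, α, β⟩, rfl⟩ | ⟨r, rfl⟩)
  · by_cases hj : j < N
    · refine Or.inr ⟨(⟨j, hj⟩, α, β), ?_⟩
      funext s
      simp [siteMatrix, hj, indicator, apply_ite Complex.ofReal]
    · refine Or.inl (Or.inr ⟨(1 : Matrix (Fin χ) (Fin χ) ℂ) α β, ?_⟩)
      funext s
      simp [siteMatrix, hj]
  · exact Or.inl (Or.inr ⟨r, rfl⟩)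

/-- One layer selects the site matrices, each site costs rank 5, and the pairing with the right
vector is one affine layer. -/
theorem computes_sequential (A : MPS N d χ) :
    ComputesComplex (indicator N d) {A.amplitude} (5 * N + 2)
      (4 * (N * d * χ ^ 2) + 36 * (N * χ ^ 2) + 4 * χ) := by
  have h1 := (ComputesComplex.vecMul_prod (N := N) (M := A.siteMatrix) (l := A.left)
    (A.computes_siteMatrix.mono (by
      rintro _ (⟨p, rfl⟩ | ⟨α, rfl⟩)
      · exact Or.inl ⟨(p.1, p.2), rfl⟩
      · exact Or.inr ⟨A.left α, rfl⟩) le_rfl le_rfl) le_rfl).affine_layer (μ := Unit) (κ := Fin χ)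
    (fun _ α s => (A.left ᵥ* ((List.range N).map (A.siteMatrix · s)).prod) α)
    (fun _ α => Or.inr ⟨α, rfl⟩) (fun _ => A.right) 0
  refine h1.mono ?_ (by omega) (by simp)
  rintro _ rfl
  refine Or.inr ⟨(), ?_⟩
  funext s
  rw [amplitude, Matrix.dotProduct_mulVec, dotProduct_comm, matrices_eq]
  simp [dotProduct]

/-- The boundary vectors are constants, so the final contraction is one affine layer with weights
`left α * right β`. -/
theorem computes_parallel (A : MPS N d χ) :
    ComputesComplex (indicator N d) {A.amplitude} (5 * Nat.clog 2 N + 2)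
      (4 * (N * d * χ ^ 2) + 36 * (2 ^ Nat.clog 2 N * χ ^ 3) + 4 * χ ^ 2) := by
  have h1 := (ComputesComplex.prod_pairwise (Nat.clog 2 N) (M := A.siteMatrix)
    (A.computes_siteMatrix.mono (by
      rintro _ ⟨p, rfl⟩
      exact Or.inl ⟨(p.1, p.2), rfl⟩) le_rfl le_rfl)).affine_layer (μ := Unit)
    (κ := Fin χ × Fin χ) (fun _ p s =>
      ((List.range (2 ^ Nat.clog 2 N)).map (A.siteMatrix · s)).prod p.1 p.2)
    (fun _ p => ⟨p, rfl⟩) (fun _ p => A.left p.1 * A.right p.2) 0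
  refine h1.mono ?_ (by omega) (by simp [sq])
  rintro _ rfl
  refine Or.inr ⟨(), ?_⟩
  funext s
  simp only [A.prod_matrices s (Nat.le_pow_clog one_lt_two N)]
  simp only [amplitude, dotProduct, Matrix.mulVec, Fintype.sum_prod_type, Finset.mul_sum,
    Pi.zero_apply, zero_add]
  exact Finset.sum_congr rfl fun α _ => Finset.sum_congr rfl fun β _ => by ring

theorem norm_vecMul_prod_le {B : ℝ} :
    ∀ (l : List (Matrix (Fin χ) (Fin χ) ℂ)), (∀ M ∈ l, ∀ α β, ‖M α β‖ ≤ B) →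
      ∀ (v : Fin χ → ℂ) (V : ℝ), (∀ α, ‖v α‖ ≤ V) →
        ∀ α, ‖(v ᵥ* l.prod) α‖ ≤ V * (χ * B) ^ l.length := by
  intro l
  induction l with
  | nil => intro _ v V hv α; simpa using hv α
  | cons M l ih =>
    intro hl v V hv α
    have h1 : ∀ β, ‖(v ᵥ* M) β‖ ≤ V * (χ * B) := by
      intro β
      calc _ ≤ ∑ γ, ‖v γ * M γ β‖ := norm_sum_le _ _
        _ ≤ ∑ _γ : Fin χ, V * B := Finset.sum_le_sum fun γ _ => by
            rw [norm_mul]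
            exact mul_le_mul (hv γ) (hl M (by simp) γ β) (norm_nonneg _)
              ((norm_nonneg _).trans (hv γ))
        _ = _ := by simp; ring
    have := ih (fun M hM => hl M (by simp [hM])) _ _ h1 α
    rw [List.prod_cons, ← Matrix.vecMul_vecMul, List.length_cons, pow_succ']
    simpa only [mul_assoc] using this

theorem norm_amplitude_le (A : MPS N d χ) {b : ℕ} (hA : A.HasPrecision b) (s : Fin N → Fin d) :
    ‖A.amplitude s‖ ≤ χ * (2 ^ b * (χ * 2 ^ b) ^ N * 2 ^ b) := by
  have h := norm_vecMul_prod_le (B := 2 ^ b) (A.matrices s)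
    (by
      intro M hM
      obtain ⟨i, rfl⟩ := (List.mem_ofFn' _ _).1 hM
      exact hA.site_le i (s i)) A.left _ hA.left_le
  rw [amplitude, Matrix.dotProduct_mulVec]
  calc _ ≤ ∑ α, ‖(A.left ᵥ* (A.matrices s).prod) α * A.right α‖ := norm_sum_le _ _
    _ ≤ ∑ _α : Fin χ, (2 ^ b * (χ * 2 ^ b) ^ N * 2 ^ b : ℝ) := Finset.sum_le_sum fun α _ => by
        rw [norm_mul]
        refine mul_le_mul ?_ (hA.right_le α) (norm_nonneg _) (by positivity)
        simpa [matrices] using h α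
    _ = _ := by simp

/-- A nonzero amplitude has a nonzero real or imaginary part, so its modulus is at least `2⁻ᵇ`. The
upper bound comes from `norm_amplitude_le` with `log χ ≤ χ` and `log 2 ≤ 1`. -/
theorem abs_log_norm_amplitude_le (A : MPS N d χ) {b : ℕ} (hA : A.HasPrecision b)
    {s : Fin N → Fin d} (hs : A.amplitude s ≠ 0) :
    |Real.log ‖A.amplitude s‖| ≤ (N + 2) * (b + χ) := by
  have h1 := A.norm_amplitude_le hA s
  have hpos : 0 < ‖A.amplitude s‖ := norm_pos_iff.2 hs
  have h2 : ((2 : ℝ) ^ b)⁻¹ ≤ ‖A.amplitude s‖ := by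
    rcases hA.re_ge s with hre | hre
    · rcases hA.im_ge s with him | him
      · exact absurd (Complex.ext hre him) hs
      · exact him.trans (Complex.abs_im_le_norm _)
    · exact hre.trans (Complex.abs_re_le_norm _)
  -- For `χ = 0` the amplitude would vanish.
  have hχ : 0 < (χ : ℝ) := by
    rcases Nat.eq_zero_or_pos χ with h | h
    · have h' : (χ : ℝ) = 0 := by simp [h]
      rw [h', zero_mul] at h1
      exact absurd hpos (not_lt.2 h1)
    · exact_mod_cast h
  have hl2 : Real.log 2 ≤ 1 := by linarith [Real.log_two_lt_d9]
  have hl0 : 0 ≤ Real.log 2 := Real.log_nonneg (by norm_num)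
  have hb : Real.log 2 * b ≤ b := by nlinarith [Nat.cast_nonneg (α := ℝ) b]
  have hlχ : Real.log χ ≤ χ := (Real.log_le_sub_one_of_pos hχ).trans (by linarith)
  have hN := Nat.cast_nonneg (α := ℝ) N
  have hb0 := Nat.cast_nonneg (α := ℝ) b
  rw [abs_le]
  constructor
  · have := Real.log_le_log (by positivity) h2
    rw [Real.log_inv, Real.log_pow] at this
    nlinarith
  · have := Real.log_le_log hpos h1
    rw [Real.log_mul (by positivity) (by positivity), Real.log_mul (by positivity) (by positivity),
      Real.log_mul (by positivity) (by positivity), Real.log_pow, Real.log_pow,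
      Real.log_mul (by positivity) (by positivity), Real.log_pow] at this
    nlinarith [mul_le_mul_of_nonneg_left hb hN, mul_le_mul_of_nonneg_left hlχ hN]

end MPS

/-! ### Parameter estimates and conclusion -/

theorem one_le_logFactor (N d χ b : ℕ) {ε : ℝ} (hε : 0 < ε) (hε1 : ε ≤ 1) :
    1 ≤ logFactor N d χ b ε := by
  have : 1 ≤ 1 / ε := by rwa [one_le_div hε]
  rw [logFactor, Real.le_log_iff_exp_le (by positivity)]
  have := Real.exp_one_lt_d9
  have : (0 : ℝ) ≤ N + d + χ + b := by positivity
  linarith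

/-- The number of steps of a binary search for the logarithm of an amplitude. -/
theorem exists_search_length (N d χ b : ℕ) {ε : ℝ} (hε : 0 < ε) (hε1 : ε ≤ 1) :
    ∃ n : ℕ, ((N + 2) * (b + χ) + Real.pi) / 2 ^ n ≤ ε / 2 ∧
      (n : ℝ) ≤ 11 * logFactor N d χ b ε := by
  have hL := one_le_logFactor N d χ b hε hε1
  set S : ℝ := 2 + N + d + χ + b + 1 / ε with hS
  have hε2 : 1 ≤ 1 / ε := by rwa [one_le_div hε]
  have hN := Nat.cast_nonneg (α := ℝ) N
  have hb := Nat.cast_nonneg (α := ℝ) b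
  have hd := Nat.cast_nonneg (α := ℝ) d
  have hχ := Nat.cast_nonneg (α := ℝ) χ
  have hS3 : 3 ≤ S := by linarith
  set T : ℝ := (N + 2) * (b + χ) + 4 with hT
  have hT2 : T ≤ 2 * S ^ 2 := by
    have : ((N : ℝ) + 2) * (b + χ) ≤ S * S :=
      mul_le_mul (by linarith) (by linarith) (by positivity) (by positivity)
    nlinarith
  have hT0 : 0 < T := by positivity
  have hTS : T * (1 / ε) * 2 ≤ S ^ 5 := by
    calc T * (1 / ε) * 2 ≤ 2 * S ^ 2 * S * 2 := by gcongr; linarith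
      _ ≤ S ^ 5 := by
        have : 0 ≤ S ^ 3 * (S ^ 2 - 4) := mul_nonneg (by positivity) (by nlinarith)
        nlinarith
  -- With `π < 4`, `T ≤ 2 S²` and `1 / ε ≤ S`, it is enough that `2 ^ n ≥ S ^ 5`, since `4 S³ ≤ S ^
  -- 5`.
  refine ⟨⌈Real.logb 2 (S ^ 5)⌉₊, ?_, ?_⟩
  · have h1 : S ^ 5 ≤ 2 ^ ⌈Real.logb 2 (S ^ 5)⌉₊ := by
      rw [← Real.rpow_natCast 2, ← Real.logb_le_iff_le_rpow (by norm_num) (by positivity)]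
      exact Nat.le_ceil _
    rw [div_le_iff₀ (by positivity)]
    have h2 : T = ε / 2 * (T * (1 / ε) * 2) := by field_simp
    calc _ ≤ T := by rw [hT]; linarith [Real.pi_lt_four]
      _ = ε / 2 * (T * (1 / ε) * 2) := h2
      _ ≤ _ := by gcongr; exact hTS.trans h1
  · have h1 := (Nat.ceil_lt_add_one (Real.logb_nonneg (b := 2) (by norm_num)
      (one_le_pow₀ (by linarith : (1 : ℝ) ≤ S) (n := 5)))).le
    have h2 : Real.logb 2 (S ^ 5) ≤ 10 * Real.log S := by
      have h4 : 0 ≤ Real.log S := Real.log_nonneg (by linarith)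
      have h5 : (1 / 2 : ℝ) ≤ Real.log 2 := by linarith [Real.log_two_gt_d9]
      rw [Real.logb, Real.log_pow, div_le_iff₀ (Real.log_pos (by norm_num))]
      have h6 := mul_le_mul_of_nonneg_left h5 h4
      push_cast
      linarith only [h6]
    have h3 : Real.log S = logFactor N d χ b ε := rfl
    linarith only [h1, h2, h3, hL]

/-- The error budget is `ε / 2` for the search and `ε / 4` for each output. With `n ≤ 11 L` search
steps, where `L` is the `logFactor`, the constants are `254 = 23 * 11 + 1` and `1410 = 128 * 11 +
2`. -/
theorem MPS.exists_neuralNet {N d χ b : ℕ} {ε : ℝ} (hε : 0 < ε) (hε1 : ε ≤ 1)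
    (A : MPS N d χ) (hA : A.HasPrecision b) (h0 : ∀ s, A.amplitude s ≠ 0) {D E : ℕ}
    (hF : ComputesComplex (MPS.indicator N d) {A.amplitude} D E) :
    ∃ net : NeuralNet (Fin N × Fin d), net.ApproximatesLog A.amplitude ε ∧
      (net.depth : ℝ) ≤ D + 254 * logFactor N d χ b ε ∧
      (net.numEdges : ℝ) ≤ E + 1410 * logFactor N d χ b ε := by
  have hL := one_le_logFactor N d χ b hε hε1
  obtain ⟨n, hn, hn'⟩ := exists_search_length N d χ b hε hε1
  obtain ⟨acc, hacc, hF⟩ := hF.exists_log_approx h0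
    (fun s => A.abs_log_norm_amplitude_le hA (h0 s)) n
  obtain ⟨net, h1, h2, h3⟩ := Computes.exists_neuralNet hF
    (fun j s => complexPart (j = 1) (acc s)) (fun j => ⟨acc, rfl, _, rfl⟩)
    (η := ε / 4) (by positivity)
  refine ⟨net, fun s => ?_, ?_, ?_⟩
  · intro x
    have e0 := h3 0 s
    have e1 := h3 1 s
    change |net.output x 0 - _| < _ at e0
    change |net.output x 1 - _| < _ at e1
    simp only [complexPart, zero_ne_one, decide_false, decide_true, cond_true, cond_false] at e0 e1
    have h4 : ‖((net.output x 0 : ℂ) + Complex.I * (net.output x 1 : ℂ)) - acc s‖ < ε / 2 := by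
      refine (Complex.norm_le_abs_re_add_abs_im _).trans_lt ?_
      simp only [Complex.sub_re, Complex.add_re, Complex.ofReal_re, Complex.mul_re, Complex.I_re,
        zero_mul, Complex.I_im, Complex.ofReal_im, mul_zero, sub_zero, add_zero, Complex.sub_im,
        Complex.add_im, Complex.mul_im, one_mul, zero_add]
      linarith
    have h5 := (hacc s).trans hn
    calc _ ≤ _ := norm_sub_le_norm_sub_add_norm_sub _ (acc s) _
      _ < ε := by linarith
  · have : (net.depth : ℝ) ≤ D + 23 * n + 1 := by exact_mod_cast h1
    linarith
  · have : (net.numEdges : ℝ) ≤ E + 128 * n + 2 := by exact_mod_cast h2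
    linarith

theorem two_pow_clog_le {N : ℕ} (hN : 0 < N) : 2 ^ Nat.clog 2 N ≤ 2 * N := by
  rcases Nat.lt_or_ge 1 N with h | h
  · have h1 := Nat.pow_pred_clog_lt_self one_lt_two h
    have h2 : Nat.clog 2 N = (Nat.clog 2 N).pred + 1 :=
      (Nat.succ_pred_eq_of_pos (Nat.clog_pos one_lt_two h)).symm
    rw [h2, pow_succ]
    omega
  · obtain rfl : N = 1 := by omega
    simp

theorem clog_two_le {N : ℕ} (hN : 0 < N) : (Nat.clog 2 N : ℝ) ≤ 2 * Real.log N + 1 := by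
  have h1 : ((2 : ℝ) ^ Nat.clog 2 N) ≤ 2 * N := by exact_mod_cast two_pow_clog_le hN
  have hN' : (1 : ℝ) ≤ N := by exact_mod_cast hN
  have h2 := Real.log_le_log (by positivity) h1
  rw [Real.log_pow, Real.log_mul (by norm_num) (by positivity)] at h2
  have h3 : (1 / 2 : ℝ) ≤ Real.log 2 := by linarith [Real.log_two_gt_d9]
  have h4 := Real.log_nonneg hN'
  by_contra! h
  nlinarith

theorem corollary2 :
    ∃ (C : ℝ) (p : ℕ), 0 < C ∧
      ∀ (N d χ b : ℕ) (ε : ℝ), 0 < ε → ε ≤ 1 →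
      ∀ A : MPS N d χ, A.HasPrecision b → (∀ s, A.amplitude s ≠ 0) →
        (∃ net : NeuralNet (Fin N × Fin d),
          net.ApproximatesLog A.sequentialContraction ε ∧
          (net.depth : ℝ) ≤ C * (N + √(1 / ε)) * logFactor N d χ b ε ^ p ∧
          (net.numEdges : ℝ) ≤ C * (N * d * χ ^ 2 + √(1 / ε)) * logFactor N d χ b ε ^ p) ∧
        (∃ net : NeuralNet (Fin N × Fin d),
          net.ApproximatesLog A.parallelContraction ε ∧
          (net.depth : ℝ) ≤ C * (Real.log N + √(1 / ε)) * logFactor N d χ b ε ^ p ∧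
          (net.numEdges : ℝ) ≤
            C * (N * (d + χ) * χ ^ 2 + √(1 / ε)) * logFactor N d χ b ε ^ p) := by
  refine ⟨2000, 1, by norm_num, fun N d χ b ε hε hε1 A hA h0 => ?_⟩
  have hL := one_le_logFactor N d χ b hε hε1
  have hsqrt : 1 ≤ √(1 / ε) := Real.one_le_sqrt.2 (by rwa [one_le_div hε])
  rw [funext A.sequentialContraction_eq, funext A.parallelContraction_eq, pow_one]
  set L := logFactor N d χ b ε
  have hlogN : 0 ≤ Real.log N := Real.log_natCast_nonneg N
  -- The additive cost of the logarithm is absorbed by `√(1 / ε) * L ≥ L`; the constant suffices as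
  -- `1410 + 500 ≤ 2000`.
  have bound : ∀ t Y : ℝ, 0 ≤ Y → t ≤ 2000 * Y + 500 → t + 1410 * L ≤ 2000 * (Y + √(1 / ε)) * L := by
    intro t Y hY ht
    have h1 : Y ≤ Y * L := le_mul_of_one_le_right hY hL
    have h2 : L ≤ √(1 / ε) * L := le_mul_of_one_le_left (by linarith) hsqrt
    linarith
  -- Here `N * d * χ ^ 2` vanishes and cannot pay for the contraction, but the amplitude is constant
  -- and costs no edges.
  by_cases hdeg : N = 0 ∨ d = 0
  · have hconst : ∃ r : ℂ, A.amplitude = fun _ => r := by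
      rcases isEmpty_or_nonempty (Fin N → Fin d) with h | ⟨⟨s₀⟩⟩
      · exact ⟨0, funext fun s => h.elim s⟩
      · refine ⟨A.amplitude s₀, funext fun s => ?_⟩
        congr 1
        funext i
        rcases hdeg with rfl | rfl
        · exact i.elim0
        · exact (s i).elim0
    obtain ⟨r, hr⟩ := hconst
    obtain ⟨net, h1, h2, h3⟩ := A.exists_neuralNet hε hε1 hA h0 (D := 0) (E := 0)
      (ComputesComplex.init.mono (by rw [hr]; rintro _ rfl; exact Or.inr ⟨r, rfl⟩) le_rfl le_rfl)
    rw [Nat.cast_zero] at h2 h3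
    have h2' : (net.depth : ℝ) ≤ 0 + 1410 * L := by linarith
    exact ⟨⟨net, h1, h2'.trans (bound _ _ (by positivity) (by positivity)),
        h3.trans (bound _ _ (by positivity) (by positivity))⟩,
      ⟨net, h1, h2'.trans (bound _ _ hlogN (by positivity)),
        h3.trans (bound _ _ (by positivity) (by positivity))⟩⟩
  · push Not at hdeg
    have hN := Nat.pos_of_ne_zero hdeg.1
    have hd := Nat.pos_of_ne_zero hdeg.2
    have hχ : χ ≤ N * d * χ ^ 2 := by
      rcases Nat.eq_zero_or_pos χ with h | h
      · simp [h]
      · calc χ = 1 * 1 * χ ^ 1 := by ring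
          _ ≤ N * d * χ ^ 2 := by gcongr <;> omega
    refine ⟨?_, ?_⟩
    · obtain ⟨net, h1, h2, h3⟩ := A.exists_neuralNet hε hε1 hA h0 A.computes_sequential
      refine ⟨net, h1, ?_, h3.trans (bound _ _ (by positivity) ?_)⟩
      · have hN0 := Nat.cast_nonneg (α := ℝ) N
        refine (h2.trans ?_).trans (bound (5 * N + 2) _ hN0 (by linarith))
        push_cast
        linarith
      · have h4 : 4 * (N * d * χ ^ 2) + 36 * (N * χ ^ 2) + 4 * χ ≤ 44 * (N * d * χ ^ 2) := by
          have : N * χ ^ 2 ≤ N * d * χ ^ 2 := by gcongr; exact Nat.le_mul_of_pos_right _ hd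
          omega
        have h5 : ((4 * (N * d * χ ^ 2) + 36 * (N * χ ^ 2) + 4 * χ : ℕ) : ℝ) ≤
            44 * (N * d * χ ^ 2) := by exact_mod_cast h4
        have : (0 : ℝ) ≤ N * d * χ ^ 2 := by positivity
        linarith
    · obtain ⟨net, h1, h2, h3⟩ := A.exists_neuralNet hε hε1 hA h0 A.computes_parallel
      refine ⟨net, h1, ?_, h3.trans (bound _ _ (by positivity) ?_)⟩
      · refine (h2.trans ?_).trans (bound (5 * (2 * Real.log N + 1) + 2) _ hlogN (by linarith))
        have := clog_two_le hN
        push_cast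
        linarith
      · have h4 : 4 * (N * d * χ ^ 2) + 36 * (2 ^ Nat.clog 2 N * χ ^ 3) + 4 * χ ^ 2 ≤
            100 * (N * (d + χ) * χ ^ 2) := by
          have e1 : 2 ^ Nat.clog 2 N * χ ^ 3 ≤ 2 * N * χ ^ 3 := by
            gcongr; exact two_pow_clog_le hN
          have e2 : χ ^ 2 ≤ N * d * χ ^ 2 :=
            Nat.le_mul_of_pos_left _ (Nat.mul_pos hN hd)
          have e3 : N * (d + χ) * χ ^ 2 = N * d * χ ^ 2 + N * χ ^ 3 := by ring
          have e4 : 2 * N * χ ^ 3 = 2 * (N * χ ^ 3) := by ring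
          omega
        have h5 : ((4 * (N * d * χ ^ 2) + 36 * (2 ^ Nat.clog 2 N * χ ^ 3) + 4 * χ ^ 2 : ℕ) : ℝ) ≤
            100 * (N * (d + χ) * χ ^ 2) := by exact_mod_cast h4
        have : (0 : ℝ) ≤ N * (d + χ) * χ ^ 2 := by positivity
        linarith
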